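/- **Setting.** Let $AP$ be a finite set of atomic propositions. A timed word over an alphabet $\Sigma$ is an infinite sequence $(\sigma_i,\tau_i)_{i\ge 1}$ over $\Sigma\times\mathbb{R}_{\ge 0}$ with $(\tau_i)$ non-decreasing and unbounded. Let $\phi$ be an $\mathsf{EMITL}_{0,\infty}$ formula over $AP$ in negative normal form, i.e. built from $\top,\bot$, atomic propositions and their negations by $\wedge$, $\vee$, automata modalities $\mathcal{A}_I(\phi_1,\dots,\phi_n)$ and dual automata modalities $\tilde{\mathcal{A}}_I(\phi_1,\dots,\phi_n)$, where $\mathcal{A}$ is an NFA over $\{1,\dots,n\}$ with one initial location and $I$ is a lower or upper bound with endpoint in $\mathbb{N}$. In the pointwise semantics, $(\rho,i)\models\mathcal{A}_I(\phi_1,\dots,\phi_n)$ iff there are $j\ge i$ with $\tau_j-\tau_i\in I$ and a word $a_i\dots a_j$ accepted by $\mathcal{A}$ with $(\rho,\ell)\models\phi_{a_\ell}$ for all $i\le\ell\le j$. Further, $\mathbf{G}\chi\equiv\neg(\top\,\mathbf{U}_{[0,\infty)}\neg\chi)$, where until is the obvious two-location automata modality, and $[\![\chi]\!]$ is the set of timed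 words $\rho$ with $(\rho,1)\models\chi$. Let $\Phi$ be the set of subformulae of $\phi$ whose outermost operator is an automata modality or a dual one. Introduce a new proposition (trigger) $p_\psi$ for each $\psi\in\Phi$, put $AP_\Phi=\{p_\psi\mid\psi\in\Phi\}$ and $\Sigma=2^{AP\cup AP_\Phi}$, and for a subformula $\chi$ of $\phi$ let $\overline{\chi}$ be the positive Boolean combination of literals obtained by replacing each top-level subformula $\psi\in\Phi$ of $\chi$ by $p_\psi$. Let $\psi=\mathcal{A}_{\le c}(\phi_1,\dots,\phi_n)\in\Phi$ with $c\in\mathbb{N}$, and let $\mathcal{A}$ have locations $S^{\mathcal{A}}$, $|S^{\mathcal{A}}|=m$, initial location $s_0^{\mathcal{A}}$ and final locations $F^{\mathcal{A}}$. Assume that $\mathcal{A}$ only accepts words of length at least $2$. For $\sigma\in\Sigma$ and $U,V\subseteq S^{\mathcal{A}}$ write $U\xrightarrow[\vee]{\sigma}V$ iff $V$ is an inclusion-minimal set such that for each $s\in U$ there are $a\in\{1,\dots,n\}$ with $\sigma\models\overline{\phi_a}$ and a transition $(s,a,s')$ of $\mathcal{A}$ with $s'\in V$. Say that $s$ *can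 finish* on $\sigma$ iff $\mathcal{A}$ has a transition $(s,a,s')$ with $\sigma\models\overline{\phi_a}$ and $s'\in F^{\mathcal{A}}$. **The automaton $\mathcal{C}^\psi$.** It is the timed automaton over $\Sigma$ with clocks $x_1,\dots,x_m$ (guards are conjunctions of comparisons of a clock with a natural number; there are no diagonal constraints), whose locations are the tuples $\langle\ell_1,S_1,\dots,\ell_m,S_m\rangle$ with $\ell_j\in\{0,1,2\}$ and $S_j\subseteq S^{\mathcal{A}}$, and whose initial location is $\langle 0,\emptyset,\dots,0,\emptyset\rangle$. Its generalised Büchi condition is $\{F_1,\dots,F_m\}$, where $F_j$ consists of the locations with $\ell_j\in\{0,2\}$. The $j$-th sub-component $\langle\ell_j,S_j\rangle$ uses only the clock $x=x_j$ and has the following transitions $\langle\ell,S\rangle\to\langle\ell',S'\rangle$ on $\sigma$. *Quiet transitions*: 1. $\ell=\ell'=0$, $S=S'=\emptyset$, guard $\top$, no reset; 2. $\ell\in\{1,2\}$, $\ell'=1$, $S\xrightarrow[\vee]{\sigma}S'$, guard $\top$, no reset; 3. $\ell\in\{1,2\}$, $\ell'=0$, $S=\{s\}$ where $s$ can finish on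 $\sigma$, $S'=\emptyset$, guard $x\le c$, no reset. *Trigger transitions*: 4. $\ell=0$, $\ell'=1$, $S=\emptyset$, $\{s_0^{\mathcal{A}}\}\xrightarrow[\vee]{\sigma}S'$, guard $\top$, reset $x$; 5. $\ell\in\{1,2\}$, $\ell'=1$, $S'=S''\cup S'''$ with $S\xrightarrow[\vee]{\sigma}S''$ and $\{s_0^{\mathcal{A}}\}\xrightarrow[\vee]{\sigma}S'''$, guard $\top$, no reset; 6. $\ell\in\{1,2\}$, $\ell'=2$, $S=\{s\}$ where $s$ can finish on $\sigma$, $\{s_0^{\mathcal{A}}\}\xrightarrow[\vee]{\sigma}S'$, guard $x\le c$, reset $x$. A transition of $\mathcal{C}^\psi$ on $\sigma$ consists of one transition of each sub-component (with the conjunction of the guards and the union of the resets): if $p_\psi\notin\sigma$, all sub-components take quiet transitions; if $p_\psi\in\sigma$, exactly one sub-component takes a trigger transition and all the others take quiet transitions. **Proposition.** $\mathcal{C}^\psi$ accepts exactly the timed words satisfying $\mathbf{G}\big(p_\psi\Rightarrow\mathcal{A}_{\le c}(\overline{\phi_1},\dots,\overline{\phi_n})\big)$, that is, $$[\![\mathcal{C}^\psi]\!]=[\![\mathbf{G}\big(p_\psi\Rightarrow\mathcal{A}_{\le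 c}(\overline{\phi_1},\dots,\overline{\phi_n})\big)]\!].$$ -/

import Mathlib

open scoped NNReal

universe u v

namespace TimedLogic

/-! ## Timed words -/

/-- A (non-Zeno) timed word over the alphabet `A`. Events are numbered from `0`:
the event at index `i` is the `(i+1)`-st event of the word. -/
structure TimedWord (A : Type u) where
  letter : ℕ → A
  time : ℕ → ℝ≥0
  mono : Monotone time
  nonZeno : ∀ r : ℝ≥0, ∃ j, r ≤ time j

/-- The delay before the event at index `i` (time starts at `0`). -/
noncomputable def TimedWord.delay {A : Type u} (w : TimedWord A) : ℕ → ℝ≥0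
  | 0 => w.time 0
  | i + 1 => w.time (i + 1) - w.time i

/-! ## Nondeterministic finite automata used as modalities -/

/-- An NFA over the `n`-ary alphabet `Fin n`, with one initial location. -/
structure ModNFA (n : ℕ) where
  Loc : Type
  [fintypeLoc : Fintype Loc]
  init : Loc
  trans : Set (Loc × Fin n × Loc)
  final : Set Loc

attribute [instance] ModNFA.fintypeLoc

/-- The underlying Mathlib automaton. -/
def ModNFA.toNFA {n : ℕ} (M : ModNFA n) : NFA (Fin n) M.Loc where
  step s a := {s' | (s, a, s') ∈ M.trans}
  start := {M.init}
  accept := M.final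

/-- Accepted words; automata modalities only run over nonempty words. -/
def ModNFA.Accepts {n : ℕ} (M : ModNFA n) (x : List (Fin n)) : Prop :=
  x ≠ [] ∧ x ∈ M.toNFA.accepts

/-! ## Formulae -/

/-- Constraining intervals that are upper bounds (`[0, c)`, `[0, c]`) or
lower bounds (`(c, ∞)`, `[c, ∞)`). -/
inductive Bound where
  | lt (c : ℕ)
  | le (c : ℕ)
  | gt (c : ℕ)
  | ge (c : ℕ)

/-- The interval of nonnegative reals described by a bound. -/
def Bound.toSet : Bound → Set ℝ≥0
  | .lt c => {t | t < c}
  | .le c => {t | t ≤ c}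
  | .gt c => {t | (c : ℝ≥0) < t}
  | .ge c => {t | (c : ℝ≥0) ≤ t}

/-- Formulae of Extended Metric Interval Temporal Logic with lower- and upper-bound
constraining intervals, over the atomic propositions `P`. -/
inductive EMITL (P : Type u) : Type (max u 1) where
  | top : EMITL P
  | atom (p : P) : EMITL P
  | and (f g : EMITL P) : EMITL P
  | neg (f : EMITL P) : EMITL P
  | aut (n : ℕ) (M : ModNFA n) (I : Bound) (args : Fin n → EMITL P) : EMITL P

namespace EMITL

variable {P : Type u}

/-- Pointwise semantics: `f.Sat w i` says that `f` holds at index `i` of `w`. For an automaton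
modality, the word `a i, a (i+1), …, a j` has to be accepted by the automaton. -/
def Sat (w : TimedWord (Set P)) : EMITL P → ℕ → Prop
  | top, _ => True
  | atom p, i => p ∈ w.letter i
  | and f g, i => f.Sat w i ∧ g.Sat w i
  | neg f, i => ¬ f.Sat w i
  | aut n M I args, i =>
      ∃ j, i ≤ j ∧ w.time j - w.time i ∈ I.toSet ∧
        ∃ a : ℕ → Fin n,
          M.Accepts (List.ofFn fun k : Fin (j - i + 1) => a (i + k)) ∧
          ∀ l, i ≤ l → l ≤ j → (args (a l)).Sat w l

/-- The timed language of a formula. -/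
def language (f : EMITL P) : Set (TimedWord (Set P)) := {w | f.Sat w 0}

def or (f g : EMITL P) : EMITL P := neg (and (neg f) (neg g))

def imp (f g : EMITL P) : EMITL P := or (neg f) g

/-- The automaton of `until`: loop on the first letter, then read the second letter once. -/
abbrev untilNFA : ModNFA 2 where
  Loc := Bool
  init := false
  trans := {(false, 0, false), (false, 1, true)}
  final := {true}

def until_ (I : Bound) (f g : EMITL P) : EMITL P := aut 2 untilNFA I ![f, g]

def eventually (f : EMITL P) : EMITL P := until_ (.ge 0) top f

def globally (f : EMITL P) : EMITL P := neg (eventually (neg f))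

end EMITL

/-- Formulae in negative normal form; `dualAut` is the dual automata modality. -/
inductive NNF (P : Type u) : Type (max u 1) where
  | top : NNF P
  | bot : NNF P
  | atom (p : P) : NNF P
  | negAtom (p : P) : NNF P
  | and (f g : NNF P) : NNF P
  | or (f g : NNF P) : NNF P
  | aut (n : ℕ) (M : ModNFA n) (I : Bound) (args : Fin n → NNF P) : NNF P
  | dualAut (n : ℕ) (M : ModNFA n) (I : Bound) (args : Fin n → NNF P) : NNF P

/-- The set of temporal subformulae, i.e. those whose outermost operator is an
automata modality or a dual automata modality. -/
def NNF.temporal {P : Type u} : NNF P → Set (NNF P)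
  | .top => ∅
  | .bot => ∅
  | .atom _ => ∅
  | .negAtom _ => ∅
  | .and f g => f.temporal ∪ g.temporal
  | .or f g => f.temporal ∪ g.temporal
  | .aut n M I args => {.aut n M I args} ∪ ⋃ a, (args a).temporal
  | .dualAut n M I args => {.dualAut n M I args} ∪ ⋃ a, (args a).temporal

theorem NNF.temporal_finite {P : Type u} (f : NNF P) : f.temporal.Finite := by
  induction f with
  | top => exact Set.finite_empty
  | bot => exact Set.finite_empty
  | atom p => exact Set.finite_empty
  | negAtom p => exact Set.finite_empty
  | and f g hf hg => exact hf.union hg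
  | or f g hf hg => exact hf.union hg
  | aut n M I args h => exact (Set.finite_singleton _).union (Set.finite_iUnion h)
  | dualAut n M I args h => exact (Set.finite_singleton _).union (Set.finite_iUnion h)

theorem NNF.temporal_subset {P : Type u} {f g : NNF P} (h : g ∈ f.temporal) :
    g.temporal ⊆ f.temporal := by
  induction f with
  | top => exact absurd h (Set.notMem_empty _)
  | bot => exact absurd h (Set.notMem_empty _)
  | atom p => exact absurd h (Set.notMem_empty _)
  | negAtom p => exact absurd h (Set.notMem_empty _)
  | and f₁ f₂ h₁ h₂ =>
    rcases h with h | h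
    · exact (h₁ h).trans Set.subset_union_left
    · exact (h₂ h).trans Set.subset_union_right
  | or f₁ f₂ h₁ h₂ =>
    rcases h with h | h
    · exact (h₁ h).trans Set.subset_union_left
    · exact (h₂ h).trans Set.subset_union_right
  | aut n M I args ih =>
    rcases h with h | h
    · rw [Set.mem_singleton_iff.1 h]
    · obtain ⟨a, ha⟩ := Set.mem_iUnion.1 h
      exact (ih a ha).trans
        ((Set.subset_iUnion (fun b => (args b).temporal) a).trans Set.subset_union_right)
  | dualAut n M I args ih =>
    rcases h with h | h
    · rw [Set.mem_singleton_iff.1 h]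
    · obtain ⟨a, ha⟩ := Set.mem_iUnion.1 h
      exact (ih a ha).trans
        ((Set.subset_iUnion (fun b => (args b).temporal) a).trans Set.subset_union_right)

theorem NNF.temporal_arg_subset {P : Type u} {f : NNF P} {n : ℕ} {M : ModNFA n} {I : Bound}
    {args : Fin n → NNF P} (h : NNF.aut n M I args ∈ f.temporal) (a : Fin n) :
    (args a).temporal ⊆ f.temporal :=
  ((Set.subset_iUnion (fun b => (args b).temporal) a).trans Set.subset_union_right).trans
    (NNF.temporal_subset h)

/-- The new atomic propositions of `f`: one trigger for each temporal subformula. -/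
abbrev Trigger {P : Type u} (f : NNF P) : Type (max u 1) := {g : NNF P // g ∈ f.temporal}

instance {P : Type u} (f : NNF P) : Finite (Trigger f) := f.temporal_finite.to_subtype

/-- The original atomic propositions together with the triggers of `f`. -/
abbrev ExtAtom {P : Type u} (f : NNF P) : Type (max u 1) := P ⊕ Trigger f

/-- Positive Boolean combinations of atomic propositions and their negations. -/
inductive PosBool (P : Type u) : Type u where
  | top : PosBool P
  | bot : PosBool P
  | atom (p : P) : PosBool P
  | negAtom (p : P) : PosBool P
  | and (f g : PosBool P) : PosBool P
  | or (f g : PosBool P) : PosBool P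

/-- Satisfaction of a Boolean combination by a single letter. -/
def PosBool.Holds {P : Type u} (σ : Set P) : PosBool P → Prop
  | .top => True
  | .bot => False
  | .atom p => p ∈ σ
  | .negAtom p => p ∉ σ
  | .and f g => f.Holds σ ∧ g.Holds σ
  | .or f g => f.Holds σ ∨ g.Holds σ

/-- A Boolean combination regarded as a formula. -/
def PosBool.toEMITL {P : Type u} : PosBool P → EMITL P
  | .top => .top
  | .bot => .neg .top
  | .atom p => .atom p
  | .negAtom p => .neg (.atom p)
  | .and f g => .and f.toEMITL g.toEMITL
  | .or f g => .or f.toEMITL g.toEMITL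

/-- Replace all top-level temporal subformulae of `g` by their triggers. -/
def overline {P : Type u} (f : NNF P) :
    (g : NNF P) → g.temporal ⊆ f.temporal → PosBool (ExtAtom f)
  | .top, _ => .top
  | .bot, _ => .bot
  | .atom p, _ => .atom (Sum.inl p)
  | .negAtom p, _ => .negAtom (Sum.inl p)
  | .and g₁ g₂, h =>
      .and (overline f g₁ (Set.subset_union_left.trans h))
        (overline f g₂ (Set.subset_union_right.trans h))
  | .or g₁ g₂, h =>
      .or (overline f g₁ (Set.subset_union_left.trans h))
        (overline f g₂ (Set.subset_union_right.trans h))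
  | .aut n M I args, h => .atom (Sum.inr ⟨.aut n M I args, h (Or.inl rfl)⟩)
  | .dualAut n M I args, h => .atom (Sum.inr ⟨.dualAut n M I args, h (Or.inl rfl)⟩)

/-! ## Timed automata -/

/-- Diagonal-free clock constraints over the clocks `X`. -/
inductive Guard (X : Type u) : Type u where
  | top : Guard X
  | and (g h : Guard X) : Guard X
  | le (x : X) (c : ℕ) : Guard X
  | lt (x : X) (c : ℕ) : Guard X
  | ge (x : X) (c : ℕ) : Guard X
  | gt (x : X) (c : ℕ) : Guard X

namespace Guard

variable {X : Type u} {Y : Type v}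

def Sat (val : X → ℝ≥0) : Guard X → Prop
  | top => True
  | and g h => g.Sat val ∧ h.Sat val
  | le x c => val x ≤ c
  | lt x c => val x < c
  | ge x c => (c : ℝ≥0) ≤ val x
  | gt x c => (c : ℝ≥0) < val x

/-- Renaming of clocks. -/
def rename (r : X → Y) : Guard X → Guard Y
  | top => top
  | and g h => and (g.rename r) (h.rename r)
  | le x c => le (r x) c
  | lt x c => lt (r x) c
  | ge x c => ge (r x) c
  | gt x c => gt (r x) c

/-- The conjunction of a finite family of constraints. -/
def conj {m : ℕ} (g : Fin m → Guard X) : Guard X := (List.ofFn g).foldr and top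

end Guard

/-- Timed automata over a finite alphabet, with a generalised Büchi condition. -/
structure TimedAutomaton (A : Type u) [Finite A] where
  Loc : Type
  [finiteLoc : Finite Loc]
  Clock : Type
  [finiteClock : Finite Clock]
  init : Loc
  trans : Set (Loc × A × Guard Clock × Set Clock × Loc)
  acc : Set (Set Loc)
  acc_finite : acc.Finite

namespace TimedAutomaton

variable {A : Type u} [Finite A]

open Classical in
/-- Reset the clocks in `R` to `0`. -/
noncomputable def reset {X : Type} (R : Set X) (val : X → ℝ≥0) : X → ℝ≥0 :=
  fun x => if x ∈ R then 0 else val x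

/-- The sequence of states `(loc i, val i)` is a run of `C` on `w`. -/
def IsRun (C : TimedAutomaton A) (w : TimedWord A) (loc : ℕ → C.Loc)
    (val : ℕ → C.Clock → ℝ≥0) : Prop :=
  loc 0 = C.init ∧ (∀ x, val 0 x = 0) ∧
    ∀ i, ∃ g R, (loc i, w.letter i, g, R, loc (i + 1)) ∈ C.trans ∧
      g.Sat (fun x => val i x + w.delay i) ∧
      val (i + 1) = reset R (fun x => val i x + w.delay i)

/-- Each set of final locations contains a location that is visited infinitely often. -/
def IsAccepting (C : TimedAutomaton A) (loc : ℕ → C.Loc) : Prop :=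
  ∀ F ∈ C.acc, ∃ s ∈ F, {i | loc i = s}.Infinite

/-- The timed language accepted by `C`. -/
def language (C : TimedAutomaton A) : Set (TimedWord A) :=
  {w | ∃ loc val, C.IsRun w loc val ∧ C.IsAccepting loc}

end TimedAutomaton

/-! ## The component automaton of an upper-bound automata modality -/

section Component

variable {P : Type u} {n : ℕ}

/-- `T` contains a successor of each location of `S` on the letter `σ`; here the letter `a` of
the automaton is enabled when `σ` satisfies `β a`. -/
def Covers (M : ModNFA n) (β : Fin n → PosBool P) (σ : Set P) (S T : Set M.Loc) : Prop :=
  ∀ s ∈ S, ∃ a, (β a).Holds σ ∧ ∃ s' ∈ T, (s, a, s') ∈ M.trans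

/-- The relation `S →∨ T`: the set `T` is inclusion-minimal among the sets that contain a
successor of each location of `S`. -/
def OrStep (M : ModNFA n) (β : Fin n → PosBool P) (σ : Set P) (S T : Set M.Loc) : Prop :=
  Minimal (Covers M β σ S) T

/-- Some final location can be reached from `s` by reading the letter `σ`. -/
def CanFinish (M : ModNFA n) (β : Fin n → PosBool P) (σ : Set P) (s : M.Loc) : Prop :=
  ∃ a, (β a).Holds σ ∧ ∃ s' ∈ M.final, (s, a, s') ∈ M.trans

/-- Locations `⟨ℓ, S⟩` of a sub-component. -/
abbrev SubLoc (M : ModNFA n) : Type := Fin 3 × Set M.Loc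

/-- Transitions of a sub-component (whose single clock is `()`) that do not take up a new
obligation. -/
inductive QuietStep (M : ModNFA n) (β : Fin n → PosBool P) (c : ℕ) (σ : Set P) :
    SubLoc M → Guard Unit → Set Unit → SubLoc M → Prop
  | idle : QuietStep M β c σ (0, ∅) .top ∅ (0, ∅)
  | proceed {l : Fin 3} {S S' : Set M.Loc} (hl : l = 1 ∨ l = 2) (h : OrStep M β σ S S') :
      QuietStep M β c σ (l, S) .top ∅ (1, S')
  | finish {l : Fin 3} {s : M.Loc} (hl : l = 1 ∨ l = 2) (h : CanFinish M β σ s) :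
      QuietStep M β c σ (l, {s}) (.le () c) ∅ (0, ∅)

/-- Transitions of a sub-component that take up a new obligation. -/
inductive TriggerStep (M : ModNFA n) (β : Fin n → PosBool P) (c : ℕ) (σ : Set P) :
    SubLoc M → Guard Unit → Set Unit → SubLoc M → Prop
  | start {S' : Set M.Loc} (h : OrStep M β σ {M.init} S') :
      TriggerStep M β c σ (0, ∅) .top {()} (1, S')
  | join {l : Fin 3} {S S₁ S₂ : Set M.Loc} (hl : l = 1 ∨ l = 2) (h₁ : OrStep M β σ S S₁)
      (h₂ : OrStep M β σ {M.init} S₂) :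
      TriggerStep M β c σ (l, S) .top ∅ (1, S₁ ∪ S₂)
  | restart {l : Fin 3} {s : M.Loc} {S' : Set M.Loc} (hl : l = 1 ∨ l = 2)
      (h : CanFinish M β σ s) (h' : OrStep M β σ {M.init} S') :
      TriggerStep M β c σ (l, {s}) (.le () c) {()} (2, S')

/-- The number `m` of sub-components: the number of locations of the automaton. -/
abbrev ModNFA.size (M : ModNFA n) : ℕ := Fintype.card M.Loc

/-- The component automaton for trigger `p`, modality `M` with constraint `[0, c]`, and
arguments `β`: the synchronisation of `m` one-clock sub-components, the `j`-th one using the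
clock `j`. When the trigger is pulled, one sub-component takes up the new obligation. -/
def component [Finite P] (p : P) (M : ModNFA n) (c : ℕ) (β : Fin n → PosBool P) :
    TimedAutomaton (Set P) where
  Loc := Fin M.size → SubLoc M
  Clock := Fin M.size
  init := fun _ => (0, ∅)
  trans := {t | ∃ (L L' : Fin M.size → SubLoc M) (σ : Set P)
      (g : Fin M.size → Guard Unit) (R : Fin M.size → Set Unit),
      t = (L, σ, Guard.conj (fun j => (g j).rename fun _ => j), {j | () ∈ R j}, L') ∧
      ((p ∉ σ ∧ ∀ j, QuietStep M β c σ (L j) (g j) (R j) (L' j)) ∨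
       (p ∈ σ ∧ ∃ k, TriggerStep M β c σ (L k) (g k) (R k) (L' k) ∧
          ∀ j, j ≠ k → QuietStep M β c σ (L j) (g j) (R j) (L' j)))}
  acc := Set.range fun j : Fin M.size =>
    {L : Fin M.size → SubLoc M | (L j).1 = 0 ∨ (L j).1 = 2}
  acc_finite := Set.finite_range _

end Component

/-- The trigger of the temporal subformula `g` of `f`. -/
def trigger {P : Type u} {f : NNF P} (g : NNF P) (h : g ∈ f.temporal) : ExtAtom f :=
  Sum.inr ⟨g, h⟩

end TimedLogic

/-! Soundness: a location held by a sub-component keeps passing to successors until the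
sub-component discharges it, and the Büchi condition forces a discharge. No reset happens before
that, and the clock is at least as old as any obligation it carries, so the guard `x ≤ c` bounds the
elapsed time of each one (`exists_finishIn_of_discharged`).

Completeness is a scheduling problem with only `m` slots. Fix, for every position and location, one
shortest way to finish, chosen by position and location alone, and let the key of a location be the
position and the last location of that path. Keys are constant along chosen paths
(`finishKey_next`). Let each busy sub-component hold locations of one key, with distinct keys in
distinct sub-components (`Coherent`). The group then finishes at a single position and has shrunk to
a single location by then, as the finishing transition demands. A new obligation joins the group
with its key if there is one, and otherwise starts an idle sub-component. An idle one exists: groups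
are disjoint, so `m` nonempty groups exhaust the `m` locations, and one of them already contains the
initial location (`Coherent.exists_slot`). Distances to the finish strictly decrease, so each
sub-component is idle infinitely often. This schedule uses neither the transition `restart` nor the
value `ℓ = 2`. -/

namespace TimedLogic

/-! ## Finite runs of a modality along a word -/

section Paths

variable {n : ℕ}

/-- From the location `s`, reading the letters at `t, …, t + k` can lead to a final location; the
letter `a` is available at `t` when `H t a` holds. -/
def FinishIn (M : ModNFA n) (H : ℕ → Fin n → Prop) : ℕ → ℕ → M.Loc → Prop
  | 0, t, s => ∃ a, H t a ∧ ∃ s' ∈ M.final, (s, a, s') ∈ M.trans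
  | k + 1, t, s => ∃ a, H t a ∧ ∃ s', (s, a, s') ∈ M.trans ∧ FinishIn M H k (t + 1) s'

/-- Links acceptance of a whole word to a recursion on single steps, which is the form that can be
compared with runs of the component. -/
theorem finishIn_iff_exists_word (M : ModNFA n) (H : ℕ → Fin n → Prop) (k t : ℕ) (s : M.Loc) :
    FinishIn M H k t s ↔ ∃ a : ℕ → Fin n,
      (List.ofFn fun l : Fin (k + 1) => a (t + l)) ∈ M.toNFA.acceptsFrom {s} ∧
      ∀ l, t ≤ l → l ≤ t + k → H l (a l) := by
  induction k generalizing t s with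
  | zero =>
    constructor
    · rintro ⟨a, ha, s', hs', htr⟩
      refine ⟨fun _ => a, ⟨s', hs', ?_⟩, fun l h₁ h₂ => ?_⟩
      · have hstep : s' ∈ M.toNFA.step s a := htr
        simpa [NFA.stepSet_singleton] using hstep
      · obtain rfl : l = t := by omega
        exact ha
    · rintro ⟨a, ⟨s', hs', hev⟩, h⟩
      have hstep : s' ∈ M.toNFA.step s (a t) := by
        simpa [NFA.stepSet_singleton] using hev
      exact ⟨a t, h t le_rfl le_rfl, s', hs', hstep⟩
  | succ k ih =>
    constructor
    · rintro ⟨a, ha, s', htr, hf⟩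
      obtain ⟨b, ⟨q, hq, hev⟩, hb⟩ := (ih _ _).1 hf
      refine ⟨fun l => if l = t then a else b l, ⟨q, hq, ?_⟩, fun l h₁ h₂ => ?_⟩
      · have hlist : (List.ofFn fun l : Fin (k + 1 + 1) => if t + (l : ℕ) = t then a else b (t + l))
            = a :: List.ofFn fun l : Fin (k + 1) => b (t + 1 + l) := by
          rw [List.ofFn_succ]
          simp [add_assoc, add_comm]
        rw [hlist, NFA.evalFrom_cons, NFA.stepSet_singleton, NFA.mem_evalFrom_iff_exists]
        exact ⟨s', htr, hev⟩
      · by_cases hl : l = t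
        · simpa [hl] using ha
        · simpa [hl] using hb l (by omega) (by omega)
    · rintro ⟨a, ⟨q, hq, hev⟩, h⟩
      have hlist : (List.ofFn fun l : Fin (k + 1 + 1) => a (t + l))
          = a t :: List.ofFn fun l : Fin (k + 1) => a (t + 1 + l) := by
        rw [List.ofFn_succ]
        simp [add_assoc, add_comm]
      rw [hlist, NFA.evalFrom_cons, NFA.stepSet_singleton, NFA.mem_evalFrom_iff_exists] at hev
      obtain ⟨s', htr, hev⟩ := hev
      exact ⟨a t, h t le_rfl (by omega), s', htr,
        (ih _ _).2 ⟨a, ⟨q, hq, hev⟩, fun l h₁ h₂ => h l (by omega) (by omega)⟩⟩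

theorem EMITL.sat_aut_iff {P : Type u} (w : TimedWord (Set P)) (M : ModNFA n) (I : Bound)
    (args : Fin n → EMITL P) (i : ℕ) :
    (EMITL.aut n M I args).Sat w i ↔ ∃ k, w.time (i + k) - w.time i ∈ I.toSet ∧
      FinishIn M (fun l a => (args a).Sat w l) k i M.init := by
  constructor
  · rintro ⟨j, hij, hI, a, hacc, ha⟩
    obtain ⟨k, rfl⟩ := Nat.exists_eq_add_of_le hij
    refine ⟨k, hI, (finishIn_iff_exists_word _ _ _ _ _).2 ⟨a, ?_, ha⟩⟩
    have h := hacc.2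
    rw [Nat.add_sub_cancel_left] at h
    exact h
  · rintro ⟨k, hI, h⟩
    obtain ⟨a, hacc, ha⟩ := (finishIn_iff_exists_word _ _ _ _ _).1 h
    refine ⟨i + k, Nat.le_add_right _ _, hI, a, ⟨by simp, ?_⟩, ha⟩
    rw [Nat.add_sub_cancel_left]
    exact hacc

theorem not_finishIn_zero_init (M : ModNFA n)
    (hM : ∀ x : List (Fin n), M.Accepts x → 2 ≤ x.length) (H : ℕ → Fin n → Prop) (t : ℕ) :
    ¬ FinishIn M H 0 t M.init := by
  intro h
  obtain ⟨a, hacc, -⟩ := (finishIn_iff_exists_word _ _ _ _ _).1 h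
  have := hM _ ⟨by simp, hacc⟩
  simp at this

theorem finishIn_untilNFA (H : ℕ → Fin 2 → Prop) (hH : ∀ t, H t 0) (k t : ℕ) :
    FinishIn EMITL.untilNFA H k t false ↔ H (t + k) 1 := by
  induction k generalizing t with
  | zero => simp [FinishIn, EMITL.untilNFA]
  | succ k ih =>
    constructor
    · rintro ⟨a, -, s', htr, h⟩
      -- The accepting location has no outgoing transition, so the path cannot enter it before its
      -- last letter.
      have hs' : s' = false := by
        by_contra hne
        have hs' : s' = true := by simpa using hne
        subst hs'
        cases k <;> simp [FinishIn, EMITL.untilNFA] at h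
      subst hs'
      have := (ih (t + 1)).1 h
      rwa [show t + (k + 1) = t + 1 + k by omega]
    · intro h
      refine ⟨0, hH t, false, by simp [EMITL.untilNFA], (ih (t + 1)).2 ?_⟩
      rwa [show t + 1 + k = t + (k + 1) by omega]

theorem EMITL.sat_globally_iff {P : Type u} (w : TimedWord (Set P)) (f : EMITL P) (i : ℕ) :
    (EMITL.globally f).Sat w i ↔ ∀ k, f.Sat w (i + k) := by
  have h : (EMITL.globally f).Sat w i ↔
      ¬ (EMITL.aut 2 EMITL.untilNFA (.ge 0) ![EMITL.top, EMITL.neg f]).Sat w i := Iff.rfl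
  rw [h, EMITL.sat_aut_iff, not_exists]
  refine forall_congr' fun k => ?_
  have hk := finishIn_untilNFA
    (fun l a => ((![EMITL.top, EMITL.neg f] : Fin 2 → EMITL P) a).Sat w l)
    (fun t => trivial) k i
  have h₁ : FinishIn EMITL.untilNFA
      (fun l a => ((![EMITL.top, EMITL.neg f] : Fin 2 → EMITL P) a).Sat w l) k i
      EMITL.untilNFA.init ↔ ¬ f.Sat w (i + k) := hk
  rw [h₁]
  simp [Bound.toSet]

theorem EMITL.sat_imp_iff {P : Type u} (w : TimedWord (Set P)) (f g : EMITL P) (i : ℕ) :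
    (EMITL.imp f g).Sat w i ↔ (f.Sat w i → g.Sat w i) := by
  simp only [EMITL.imp, EMITL.or, EMITL.Sat]
  tauto

theorem PosBool.sat_toEMITL_iff {P : Type u} (w : TimedWord (Set P)) (f : PosBool P) (i : ℕ) :
    f.toEMITL.Sat w i ↔ f.Holds (w.letter i) := by
  induction f with
  | top => simp [PosBool.toEMITL, EMITL.Sat, PosBool.Holds]
  | bot => simp [PosBool.toEMITL, EMITL.Sat, PosBool.Holds]
  | atom p => simp [PosBool.toEMITL, EMITL.Sat, PosBool.Holds]
  | negAtom p => simp [PosBool.toEMITL, EMITL.Sat, PosBool.Holds]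
  | and f g hf hg => simp [PosBool.toEMITL, EMITL.Sat, PosBool.Holds, hf, hg]
  | or f g hf hg =>
    simp only [PosBool.toEMITL, EMITL.or, EMITL.Sat, PosBool.Holds, hf, hg]
    tauto

theorem mem_language_globally_iff {P : Type u} (w : TimedWord (Set P)) (p : P) (M : ModNFA n)
    (c : ℕ) (β : Fin n → PosBool P) :
    w ∈ (EMITL.globally (EMITL.imp (EMITL.atom p)
        (EMITL.aut n M (.le c) (fun a => (β a).toEMITL)))).language ↔
      ∀ t, p ∈ w.letter t → ∃ k, w.time (t + k) ≤ c + w.time t ∧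
        FinishIn M (fun l a => (β a).Holds (w.letter l)) k t M.init := by
  change EMITL.Sat w _ 0 ↔ _
  simp only [EMITL.sat_globally_iff, zero_add, EMITL.sat_imp_iff, EMITL.sat_aut_iff,
    PosBool.sat_toEMITL_iff, Bound.toSet, Set.mem_ofPred_eq, tsub_le_iff_right]
  rfl

end Paths

/-! ## Runs of the component automaton -/

section Runs

variable {P : Type u} {n : ℕ}

theorem Guard.sat_conj_iff {X : Type} {m : ℕ} (g : Fin m → Guard X) (val : X → ℝ≥0) :
    (Guard.conj g).Sat val ↔ ∀ j, (g j).Sat val := by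
  have h : ∀ l : List (Guard X), (l.foldr Guard.and Guard.top).Sat val ↔ ∀ x ∈ l, x.Sat val := by
    intro l
    induction l with
    | nil => simp [Guard.Sat]
    | cons a l ih => simp [Guard.Sat, ih]
  rw [Guard.conj, h]
  simp [List.mem_ofFn]

theorem Guard.sat_rename_iff {X Y : Type} (r : X → Y) (g : Guard X) (val : Y → ℝ≥0) :
    (g.rename r).Sat val ↔ g.Sat (fun x => val (r x)) := by
  induction g with
  | and g h ihg ihh => simp [Guard.rename, Guard.Sat, ihg, ihh]
  | _ => simp [Guard.rename, Guard.Sat]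

/-- A step of the component automaton, described through its sub-components. -/
def ComponentStep (p : P) (M : ModNFA n) (c : ℕ) (β : Fin n → PosBool P) (σ : Set P)
    (L L' : Fin M.size → SubLoc M) (val val' : Fin M.size → ℝ≥0) : Prop :=
  ∃ (g : Fin M.size → Guard Unit) (R : Fin M.size → Set Unit),
    ((p ∉ σ ∧ ∀ j, QuietStep M β c σ (L j) (g j) (R j) (L' j)) ∨
      (p ∈ σ ∧ ∃ k, TriggerStep M β c σ (L k) (g k) (R k) (L' k) ∧
        ∀ j, j ≠ k → QuietStep M β c σ (L j) (g j) (R j) (L' j))) ∧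
    (∀ j, (g j).Sat (fun _ => val j)) ∧
    ∀ j, (() ∈ R j → val' j = 0) ∧ (() ∉ R j → val' j = val j)

theorem isRun_component_iff [Finite P] (p : P) (M : ModNFA n) (c : ℕ) (β : Fin n → PosBool P)
    (w : TimedWord (Set P)) (L : ℕ → Fin M.size → SubLoc M) (val : ℕ → Fin M.size → ℝ≥0) :
    (component p M c β).IsRun w L val ↔
      (L 0 = fun _ => (0, ∅)) ∧ (∀ j, val 0 j = 0) ∧
      ∀ t, ComponentStep p M c β (w.letter t) (L t) (L (t + 1))
        (fun j => val t j + w.delay t) (val (t + 1)) := by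
  unfold TimedAutomaton.IsRun
  refine and_congr Iff.rfl (and_congr Iff.rfl (forall_congr' fun t => ?_))
  have hreset : ∀ (R : Fin M.size → Set Unit) (v v' : Fin M.size → ℝ≥0),
      v' = TimedAutomaton.reset {j | () ∈ R j} v ↔
        ∀ j, (() ∈ R j → v' j = 0) ∧ (() ∉ R j → v' j = v j) := by
    intro R v v'
    rw [funext_iff]
    refine forall_congr' fun j => ?_
    by_cases hj : () ∈ R j <;> simp [TimedAutomaton.reset, hj]
  have hguard : ∀ (g : Fin M.size → Guard Unit) (v : Fin M.size → ℝ≥0),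
      (Guard.conj fun j => (g j).rename fun _ => j).Sat v ↔
        ∀ j, (g j).Sat (fun _ => v j) := by
    intro g v
    rw [Guard.sat_conj_iff]
    exact forall_congr' fun j => Guard.sat_rename_iff _ _ _
  constructor
  · rintro ⟨G, R', ⟨L₁, L₂, σ, g, R, heq, hstep⟩, hg, hv⟩
    obtain ⟨h₁, heq⟩ := Prod.mk.inj heq
    obtain ⟨h₂, heq⟩ := Prod.mk.inj heq
    obtain ⟨h₃, heq⟩ := Prod.mk.inj heq
    obtain ⟨h₄, h₅⟩ := Prod.mk.inj heq
    subst h₁ h₂ h₃ h₄ h₅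
    exact ⟨g, R, hstep, (hguard _ _).1 hg, (hreset _ _ _).1 hv⟩
  · rintro ⟨g, R, hstep, hg, hv⟩
    exact ⟨_, _, ⟨_, _, _, g, R, rfl, hstep⟩, (hguard _ _).2 hg, (hreset _ _ _).2 hv⟩

theorem TimedWord.delay_succ_add {A : Type u} (w : TimedWord A) (t : ℕ) :
    w.delay (t + 1) + w.time t = w.time (t + 1) :=
  tsub_add_cancel_of_le (w.mono (Nat.le_succ t))

end Runs

/-! ## Soundness -/

section Soundness

variable {P : Type u} {n : ℕ}

/-- An obligation held by a sub-component is met in time, provided that the sub-component is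
discharged eventually. -/
theorem exists_finishIn_of_discharged {p : P} {M : ModNFA n} {c : ℕ} {β : Fin n → PosBool P}
    {w : TimedWord (Set P)} {L : ℕ → Fin M.size → SubLoc M} {val : ℕ → Fin M.size → ℝ≥0}
    (hrun : ∀ t, ComponentStep p M c β (w.letter t) (L t) (L (t + 1))
        (fun j => val t j + w.delay t) (val (t + 1)))
    (j : Fin M.size) (N t : ℕ) (s : M.Loc) (hs : s ∈ (L t j).2)
    (hN : (L (t + N + 1) j).1 = 0 ∨ (L (t + N + 1) j).1 = 2) :
    ∃ k, FinishIn M (fun l a => (β a).Holds (w.letter l)) k t s ∧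
      val t j + w.delay t + w.time (t + k) ≤ c + w.time t := by
  induction N generalizing t s with
  | zero =>
    obtain ⟨g, R, hstep, hg, -⟩ := hrun t
    have key : QuietStep M β c (w.letter t) (L t j) (g j) (R j) (L (t + 1) j) ∨
        TriggerStep M β c (w.letter t) (L t j) (g j) (R j) (L (t + 1) j) := by
      rcases hstep with ⟨-, h⟩ | ⟨-, k, hk, h⟩
      · exact Or.inl (h j)
      · by_cases hj : j = k
        · exact Or.inr (hj ▸ hk)
        · exact Or.inl (h j hj)
    have hgj := hg j
    rw [add_zero] at hN
    generalize L t j = A at key hs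
    generalize L (t + 1) j = B at key hN
    generalize g j = G at key hgj
    generalize R j = Q at key
    -- The target has `ℓ` equal to 0 or 2, so a nonempty source leaves only `finish` and `restart`;
    -- their guard is the bound for `k = 0`.
    rcases key with key | key
    · cases key with
      | idle => exact absurd hs (Set.notMem_empty _)
      | proceed => simp at hN
      | finish hl h =>
        obtain rfl : s = _ := hs
        exact ⟨0, h, add_le_add hgj le_rfl⟩
    · cases key with
      | start => exact absurd hs (Set.notMem_empty _)
      | join => simp at hN
      | restart hl h h' =>
        obtain rfl : s = _ := hs
        exact ⟨0, h, add_le_add hgj le_rfl⟩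
  | succ N ih =>
    obtain ⟨g, R, hstep, hg, hv⟩ := hrun t
    have key : QuietStep M β c (w.letter t) (L t j) (g j) (R j) (L (t + 1) j) ∨
        TriggerStep M β c (w.letter t) (L t j) (g j) (R j) (L (t + 1) j) := by
      rcases hstep with ⟨-, h⟩ | ⟨-, k, hk, h⟩
      · exact Or.inl (h j)
      · by_cases hj : j = k
        · exact Or.inr (hj ▸ hk)
        · exact Or.inl (h j hj)
    have hgj := hg j
    have hvj := (hv j).2
    -- Common to `proceed` and `join`: the obligation moves to a successor and the clock is not
    -- reset, so both sides of the bound grow by the same delay.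
    have next : ∀ S', Covers M β (w.letter t) (L t j).2 S' → S' ⊆ (L (t + 1) j).2 → () ∉ R j →
        ∃ k, FinishIn M (fun l a => (β a).Holds (w.letter l)) k t s ∧
          val t j + w.delay t + w.time (t + k) ≤ c + w.time t := by
      intro S' hcov hsub hR
      obtain ⟨a, ha, s', hs', htr⟩ := hcov s hs
      obtain ⟨k, hk, htime⟩ := ih (t + 1) s' (hsub hs')
        (by rwa [show t + 1 + N + 1 = t + (N + 1) + 1 by omega])
      refine ⟨k + 1, ⟨a, ha, s', htr, hk⟩, ?_⟩
      rw [hvj hR, ← w.delay_succ_add, show t + 1 + k = t + (k + 1) by omega] at htime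
      have : (val t j + w.delay t + w.time (t + (k + 1))) + w.delay (t + 1) ≤
          (c + w.time t) + w.delay (t + 1) := by
        convert htime using 1 <;> ring
      exact le_of_add_le_add_right this
    clear hv
    generalize L t j = A at key hs next
    generalize L (t + 1) j = B at key next
    generalize g j = G at key hgj
    generalize R j = Q at key next
    rcases key with key | key
    · cases key with
      | idle => exact absurd hs (Set.notMem_empty _)
      | proceed hl h => exact next _ h.prop subset_rfl (Set.notMem_empty _)
      | finish hl h =>
        obtain rfl : s = _ := hs
        exact ⟨0, h, add_le_add hgj le_rfl⟩
    · cases key with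
      | start => exact absurd hs (Set.notMem_empty _)
      | join hl h₁ h₂ => exact next _ h₁.prop Set.subset_union_left (Set.notMem_empty _)
      | restart hl h h' =>
        obtain rfl : s = _ := hs
        exact ⟨0, h, add_le_add hgj le_rfl⟩

theorem TriggerStep.exists_covers_init {M : ModNFA n} {c : ℕ} {β : Fin n → PosBool P} {σ : Set P}
    {A B : SubLoc M} {g : Guard Unit} {R : Set Unit} (h : TriggerStep M β c σ A g R B) :
    Covers M β σ {M.init} B.2 := by
  cases h with
  | start h => exact h.prop
  | join hl h₁ h₂ =>
    intro s hs
    obtain ⟨a, ha, s', hs', htr⟩ := h₂.prop s hs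
    exact ⟨a, ha, s', Or.inr hs', htr⟩
  | restart hl h h' => exact h'.prop

theorem exists_finishIn_of_mem_language [Finite P] {p : P} {M : ModNFA n} {c : ℕ}
    {β : Fin n → PosBool P} {w : TimedWord (Set P)} (hw : w ∈ (component p M c β).language)
    (t : ℕ) (hp : p ∈ w.letter t) :
    ∃ k, w.time (t + k) ≤ c + w.time t ∧
      FinishIn M (fun l a => (β a).Holds (w.letter l)) k t M.init := by
  obtain ⟨L, val, hrun, hacc⟩ := hw
  replace hrun := ((isRun_component_iff p M c β w L val).1 hrun).2.2
  obtain ⟨g, R, hstep, -, -⟩ := hrun t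
  rcases hstep with ⟨h, -⟩ | ⟨-, k, hk, -⟩
  · exact absurd hp h
  obtain ⟨a, ha, s', hs', htr⟩ := hk.exists_covers_init _ rfl
  obtain ⟨l, hl, hinf⟩ := hacc _ ⟨k, rfl⟩
  obtain ⟨i, hi, hti⟩ := hinf.exists_gt (t + 1)
  obtain ⟨N, rfl⟩ := Nat.exists_eq_add_of_lt hti
  have hi' : L (t + 1 + N + 1) = l := hi
  obtain ⟨d, hd, htime⟩ := exists_finishIn_of_discharged hrun k N (t + 1) s' hs'
    (by rw [hi']; exact hl)
  refine ⟨d + 1, ?_, a, ha, s', htr, hd⟩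
  rw [← w.delay_succ_add, show t + 1 + d = t + (d + 1) by omega] at htime
  -- Dropping `val (t + 1) k` is harmless: a clock started by an earlier obligation only makes the
  -- bound stronger.
  have h : w.time (t + (d + 1)) + w.delay (t + 1) ≤ (c + w.time t) + w.delay (t + 1) := by
    calc w.time (t + (d + 1)) + w.delay (t + 1)
        ≤ val (t + 1) k + w.delay (t + 1) + w.time (t + (d + 1)) := by
          rw [add_comm (w.time _), add_assoc]; exact le_add_self
      _ ≤ _ := htime
      _ = _ := by ring
  exact le_of_add_le_add_right h

end Soundness

/-! ## Shortest finishing paths -/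

section Shortest

variable {n : ℕ}

/-- The least number of letters, after the one at `t`, needed to finish from `s`. -/
noncomputable def finishDist (M : ModNFA n) (H : ℕ → Fin n → Prop) (t : ℕ) (s : M.Loc) : ℕ :=
  sInf {k | FinishIn M H k t s}

open Classical in
/-- A successor of `s` on a shortest finishing path. -/
noncomputable def finishNext (M : ModNFA n) (H : ℕ → Fin n → Prop) (t : ℕ) (s : M.Loc) : M.Loc :=
  if h : ∃ s', (∃ a, H t a ∧ (s, a, s') ∈ M.trans) ∧
      FinishIn M H (finishDist M H t s - 1) (t + 1) s' then h.choose else s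

/-- The location that is reached after `k` steps along the chosen shortest path. -/
noncomputable def finishLast (M : ModNFA n) (H : ℕ → Fin n → Prop) : ℕ → ℕ → M.Loc → M.Loc
  | 0, _, s => s
  | k + 1, t, s => finishLast M H k (t + 1) (finishNext M H t s)

/-- The position at which the chosen shortest path finishes, and the location from which it
finishes. -/
noncomputable def finishKey (M : ModNFA n) (H : ℕ → Fin n → Prop) (t : ℕ) (s : M.Loc) :
    ℕ × M.Loc :=
  (t + finishDist M H t s, finishLast M H (finishDist M H t s) t s)

variable {M : ModNFA n} {H : ℕ → Fin n → Prop} {t : ℕ} {s : M.Loc}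

/-- Since `sInf ∅ = 0`, a distance means something only when some finishing path exists; this is why
the hypothesis recurs below. -/
theorem finishIn_finishDist (h : ∃ k, FinishIn M H k t s) :
    FinishIn M H (finishDist M H t s) t s :=
  Nat.sInf_mem h

theorem finishNext_spec (h : ∃ k, FinishIn M H k t s) (hd : 0 < finishDist M H t s) :
    (∃ a, H t a ∧ (s, a, finishNext M H t s) ∈ M.trans) ∧
      FinishIn M H (finishDist M H t s - 1) (t + 1) (finishNext M H t s) := by
  have hex : ∃ s', (∃ a, H t a ∧ (s, a, s') ∈ M.trans) ∧
      FinishIn M H (finishDist M H t s - 1) (t + 1) s' := by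
    have h₁ := finishIn_finishDist h
    obtain ⟨k, hk⟩ := Nat.exists_eq_succ_of_ne_zero hd.ne'
    rw [hk] at h₁ ⊢
    obtain ⟨a, ha, s', htr, hf⟩ := h₁
    exact ⟨s', ⟨a, ha, htr⟩, hf⟩
  rw [finishNext, dif_pos hex]
  exact hex.choose_spec

/-- A shorter path from the successor would, with one letter prepended, beat the shortest path from
`s`. -/
theorem finishDist_next (h : ∃ k, FinishIn M H k t s) (hd : 0 < finishDist M H t s) :
    finishDist M H (t + 1) (finishNext M H t s) + 1 = finishDist M H t s := by
  obtain ⟨⟨a, ha, htr⟩, hf⟩ := finishNext_spec h hd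
  have h₁ : finishDist M H (t + 1) (finishNext M H t s) ≤ finishDist M H t s - 1 :=
    Nat.sInf_le hf
  have h₂ : finishDist M H t s ≤ finishDist M H (t + 1) (finishNext M H t s) + 1 :=
    Nat.sInf_le (s := {k | FinishIn M H k t s})
      ⟨a, ha, _, htr, finishIn_finishDist ⟨_, hf⟩⟩
  omega

/-- The choice of successor depends only on position and location, so the path chosen from the
successor is the tail of the path chosen from `s`. -/
theorem finishKey_next (h : ∃ k, FinishIn M H k t s) (hd : 0 < finishDist M H t s) :
    finishKey M H (t + 1) (finishNext M H t s) = finishKey M H t s := by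
  have h₁ := finishDist_next h hd
  simp only [finishKey]
  rw [← h₁]
  refine Prod.ext ?_ rfl
  dsimp only
  omega

theorem finishDist_eq_of_key_eq {s' : M.Loc} (h : finishKey M H t s = finishKey M H t s') :
    finishDist M H t s = finishDist M H t s' :=
  Nat.add_left_cancel (congrArg Prod.fst h)

theorem eq_of_finishKey_eq {s' : M.Loc} (h : finishKey M H t s = finishKey M H t s')
    (hd : finishDist M H t s = 0) : s = s' := by
  have h₂ := congrArg Prod.snd h
  have hd' := (finishDist_eq_of_key_eq h).symm.trans hd
  simpa only [finishKey, hd, hd', finishLast] using h₂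

/-- The chosen successors form a cover, and subsets of a finite set are well-founded, so a minimal
cover lies inside it. Minimality may discard some chosen successors, but everything kept lies on a
chosen path. -/
theorem exists_orStep {P : Type u} {β : Fin n → PosBool P} {σ : ℕ → Set P} {t : ℕ}
    (S : Set M.Loc) (hS : ∀ s ∈ S, (∃ k, FinishIn M (fun l a => (β a).Holds (σ l)) k t s) ∧
      0 < finishDist M (fun l a => (β a).Holds (σ l)) t s) :
    ∃ T, OrStep M β (σ t) S T ∧
      T ⊆ finishNext M (fun l a => (β a).Holds (σ l)) t '' S ∧ (S.Nonempty → T.Nonempty) := by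
  have hcov : Covers M β (σ t) S (finishNext M (fun l a => (β a).Holds (σ l)) t '' S) := by
    intro s hs
    obtain ⟨⟨a, ha, htr⟩, -⟩ := finishNext_spec (hS s hs).1 (hS s hs).2
    exact ⟨a, ha, _, ⟨s, hs, rfl⟩, htr⟩
  obtain ⟨T, hT, hmin⟩ := exists_minimal_le_of_wellFoundedLT (Covers M β (σ t) S) _ hcov
  refine ⟨T, hmin, hT, fun ⟨s, hs⟩ => ?_⟩
  obtain ⟨a, -, s', hs', -⟩ := hmin.prop s hs
  exact ⟨s', hs'⟩

end Shortest

/-! ## Completeness -/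

section Completeness

variable {P : Type u} {n : ℕ}

/-- The states of the component automaton that are used at position `t`: each busy sub-component
holds locations sharing their key, different sub-components hold different keys, and there is
enough time left to finish. -/
structure Coherent (M : ModNFA n) (c : ℕ) (H : ℕ → Fin n → Prop) (w : TimedWord (Set P)) (t : ℕ)
    (L : Fin M.size → SubLoc M) (val : Fin M.size → ℝ≥0) : Prop where
  idle_or : ∀ j, L j = (0, ∅) ∨ (L j).1 = 1 ∧ (L j).2.Nonempty
  live : ∀ j, ∀ s ∈ (L j).2, ∃ k, FinishIn M H k t s
  time : ∀ j, ∀ s ∈ (L j).2, val j + w.delay t + w.time (finishKey M H t s).1 ≤ c + w.time t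
  key : ∀ i j, ∀ s ∈ (L i).2, ∀ s' ∈ (L j).2, finishKey M H t s = finishKey M H t s' ↔ i = j

/-- `B` is a sub-component location reached from `S` along the chosen shortest paths. -/
structure Follows (M : ModNFA n) (H : ℕ → Fin n → Prop) (t : ℕ) (S : Set M.Loc)
    (B : SubLoc M) : Prop where
  idle_or : B = (0, ∅) ∨ B.1 = 1 ∧ B.2.Nonempty
  exists_eq : ∀ s' ∈ B.2, ∃ s ∈ S, 0 < finishDist M H t s ∧ s' = finishNext M H t s

theorem exists_quietStep {M : ModNFA n} {c : ℕ} {β : Fin n → PosBool P} {w : TimedWord (Set P)}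
    {t : ℕ} {L : Fin M.size → SubLoc M} {val : Fin M.size → ℝ≥0}
    (hL : Coherent M c (fun l a => (β a).Holds (w.letter l)) w t L val) (j : Fin M.size) :
    ∃ g B, QuietStep M β c (w.letter t) (L j) g ∅ B ∧ g.Sat (fun _ => val j + w.delay t) ∧
      Follows M (fun l a => (β a).Holds (w.letter l)) t (L j).2 B := by
  rcases hL.idle_or j with h | ⟨h₁, s, hs⟩
  · rw [h]
    exact ⟨_, _, .idle, trivial, Or.inl rfl, fun _ h => absurd h (Set.notMem_empty _)⟩
  · have hkey : ∀ s' ∈ (L j).2, finishKey M (fun l a => (β a).Holds (w.letter l)) t s =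
        finishKey M (fun l a => (β a).Holds (w.letter l)) t s' :=
      fun s' hs' => (hL.key j j s hs s' hs').2 rfl
    rcases Nat.eq_zero_or_pos (finishDist M (fun l a => (β a).Holds (w.letter l)) t s)
      with hd | hd
    · have hS : (L j).2 = {s} :=
        Set.eq_singleton_iff_unique_mem.2
          ⟨hs, fun s' hs' => (eq_of_finishKey_eq (hkey s' hs') hd).symm⟩
      have hfin : CanFinish M β (w.letter t) s := by
        have := finishIn_finishDist (hL.live j s hs)
        rw [hd] at this
        exact this
      have htime := hL.time j s hs
      rw [finishKey, hd] at htime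
      refine ⟨.le () c, (0, ∅), ?_, le_of_add_le_add_right htime, Or.inl rfl,
        fun _ h => absurd h (Set.notMem_empty _)⟩
      rw [show L j = (1, {s}) from Prod.ext h₁ hS]
      exact .finish (Or.inl rfl) hfin
    · obtain ⟨T, hT, hsub, hne⟩ := exists_orStep (σ := w.letter) (β := β) (t := t) (L j).2
        fun s' hs' => ⟨hL.live j s' hs', by rwa [← finishDist_eq_of_key_eq (hkey s' hs')]⟩
      refine ⟨.top, (1, T), .proceed (Or.inl h₁) hT, trivial, Or.inr ⟨rfl, hne ⟨s, hs⟩⟩, ?_⟩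
      intro s' hs'
      obtain ⟨r, hr, rfl⟩ := hsub hs'
      exact ⟨r, hr, by rwa [← finishDist_eq_of_key_eq (hkey r hr)], rfl⟩

/-- Following shortest paths from sources with coherent keys preserves coherence. -/
theorem Coherent.of_follows {M : ModNFA n} {c : ℕ} {H : ℕ → Fin n → Prop}
    {w : TimedWord (Set P)} {t : ℕ} {S : Fin M.size → Set M.Loc} {L' : Fin M.size → SubLoc M}
    {val' : Fin M.size → ℝ≥0} (hlive : ∀ j, ∀ s ∈ S j, ∃ k, FinishIn M H k t s)
    (htime : ∀ j, ∀ s ∈ S j, val' j + w.time (finishKey M H t s).1 ≤ c + w.time t)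
    (hkey : ∀ i j, ∀ s ∈ S i, ∀ s' ∈ S j, finishKey M H t s = finishKey M H t s' ↔ i = j)
    (hL' : ∀ j, Follows M H t (S j) (L' j)) : Coherent M c H w (t + 1) L' val' where
  idle_or j := (hL' j).idle_or
  live j s' hs' := by
    obtain ⟨s, hs, hd, rfl⟩ := (hL' j).exists_eq s' hs'
    exact ⟨_, (finishNext_spec (hlive j s hs) hd).2⟩
  time j s' hs' := by
    obtain ⟨s, hs, hd, rfl⟩ := (hL' j).exists_eq s' hs'
    -- The finishing position does not change, so both sides merely gain `w.delay (t + 1)`.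
    rw [finishKey_next (hlive j s hs) hd, ← w.delay_succ_add]
    calc val' j + w.delay (t + 1) + w.time (finishKey M H t s).1
        = w.delay (t + 1) + (val' j + w.time (finishKey M H t s).1) := by ring
      _ ≤ w.delay (t + 1) + (c + w.time t) := add_le_add le_rfl (htime j s hs)
      _ = _ := by ring
  key i j s hs s' hs' := by
    obtain ⟨r, hr, hd, rfl⟩ := (hL' i).exists_eq s hs
    obtain ⟨r', hr', hd', rfl⟩ := (hL' j).exists_eq s' hs'
    rw [finishKey_next (hlive i r hr) hd, finishKey_next (hlive j r' hr') hd']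
    exact hkey i j r hr r' hr'

/-- The sub-component that takes up a new obligation. -/
theorem Coherent.exists_slot {M : ModNFA n} {c : ℕ} {H : ℕ → Fin n → Prop}
    {w : TimedWord (Set P)} {t : ℕ} {L : Fin M.size → SubLoc M} {val : Fin M.size → ℝ≥0}
    (hL : Coherent M c H w t L val) :
    ∃ k, (∃ s ∈ (L k).2, finishKey M H t s = finishKey M H t M.init) ∨
      L k = (0, ∅) ∧ ∀ j, ∀ s ∈ (L j).2, finishKey M H t s ≠ finishKey M H t M.init := by
  by_contra! hno
  have hkey : ∀ j, ∀ s ∈ (L j).2, finishKey M H t s ≠ finishKey M H t M.init :=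
    fun j => (hno j).1
  have hbusy : ∀ j, ∃ s, s ∈ (L j).2 := by
    intro j
    rcases hL.idle_or j with h | h
    · obtain ⟨i, s, hs, he⟩ := (hno j).2 h
      exact absurd he (hkey i s hs)
    · exact h.2
  -- One location per sub-component: these are distinct because the keys are, so by counting they
  -- are all the locations, `M.init` among them.
  choose f hf using hbusy
  have hinj : Function.Injective f := fun i j hij =>
    (hL.key i j _ (hf i) _ (hf j)).1 (by rw [hij])
  obtain ⟨j, hj⟩ := ((Fintype.bijective_iff_injective_and_card f).2 ⟨hinj, by simp⟩).2 M.init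
  exact hkey j _ (hf j) (by rw [hj])

/-- The last conjunct, the strict decrease of distances, is what later yields the Büchi condition.
-/
theorem Coherent.exists_componentStep {p : P} {M : ModNFA n} {c : ℕ} {β : Fin n → PosBool P}
    {w : TimedWord (Set P)} (hM : ∀ x : List (Fin n), M.Accepts x → 2 ≤ x.length)
    (hw : ∀ t, p ∈ w.letter t → ∃ k, w.time (t + k) ≤ c + w.time t ∧
        FinishIn M (fun l a => (β a).Holds (w.letter l)) k t M.init)
    {t : ℕ} {L : Fin M.size → SubLoc M} {val : Fin M.size → ℝ≥0}
    (hL : Coherent M c (fun l a => (β a).Holds (w.letter l)) w t L val) :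
    ∃ L' val', ComponentStep p M c β (w.letter t) L L' (fun j => val j + w.delay t) val' ∧
      Coherent M c (fun l a => (β a).Holds (w.letter l)) w (t + 1) L' val' ∧
      ∀ j, ∀ s' ∈ (L' j).2, ∀ s ∈ (L j).2,
        finishDist M (fun l a => (β a).Holds (w.letter l)) (t + 1) s' <
          finishDist M (fun l a => (β a).Holds (w.letter l)) t s := by
  classical
  set H : ℕ → Fin n → Prop := fun l a => (β a).Holds (w.letter l)
  choose g B hstep hg hB using exists_quietStep hL
  by_cases hp : p ∈ w.letter t
  swap
  · refine ⟨B, fun j => val j + w.delay t, ⟨g, fun _ => ∅, Or.inl ⟨hp, hstep⟩, hg,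
      fun j => ⟨fun h => absurd h (Set.notMem_empty _), fun _ => rfl⟩⟩,
      .of_follows hL.live hL.time hL.key hB, ?_⟩
    intro j s' hs' s hs
    obtain ⟨r, hr, hd, rfl⟩ := (hB j).exists_eq s' hs'
    rw [← finishDist_eq_of_key_eq ((hL.key j j r hr s hs).2 rfl)]
    exact Nat.lt_of_succ_le (finishDist_next (hL.live j r hr) hd).le
  · obtain ⟨d, hdtime, hd⟩ := hw t hp
    have hinit : ∃ k, FinishIn M H k t M.init := ⟨d, hd⟩
    -- Here the exclusion of one-letter words is used: a group sharing the key of `M.init` is not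
    -- due to finish at this event, so it can be joined.
    have hpos : 0 < finishDist M H t M.init := by
      refine Nat.pos_of_ne_zero fun h => not_finishIn_zero_init M hM H t ?_
      rw [← h]
      exact finishIn_finishDist hinit
    have htimeinit : w.time (finishKey M H t M.init).1 ≤ c + w.time t :=
      (w.mono (Nat.add_le_add_left (Nat.sInf_le hd) t)).trans hdtime
    obtain ⟨T, hT, hTsub, hTne⟩ := exists_orStep (σ := w.letter) (β := β) (t := t) {M.init}
      (by rintro s rfl; exact ⟨hinit, hpos⟩)
    have hTnext : ∀ s' ∈ T, s' = finishNext M H t M.init := by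
      intro s' hs'
      obtain ⟨r, rfl, rfl⟩ := hTsub hs'
      rfl
    obtain ⟨k, hk⟩ := hL.exists_slot
    -- It suffices to describe the step of the sub-component `k`.
    suffices hsuff : ∃ G R C v, TriggerStep M β c (w.letter t) (L k) G R C ∧
        G.Sat (fun _ => val k + w.delay t) ∧
        ((() ∈ R → v = 0) ∧ (() ∉ R → v = val k + w.delay t)) ∧
        Follows M H t ((L k).2 ∪ {M.init}) C ∧
        (∀ s ∈ (L k).2, v + w.time (finishKey M H t s).1 ≤ c + w.time t) ∧
        v + w.time (finishKey M H t M.init).1 ≤ c + w.time t by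
      obtain ⟨G, R, C, v, hC, hG, hv, hCf, hv₁, hv₂⟩ := hsuff
      have hkinit : ∀ j, ∀ s ∈ (L j).2,
          finishKey M H t s = finishKey M H t M.init ↔ j = k := by
        intro j s hs
        rcases hk with ⟨r, hr, hkey⟩ | ⟨hidle, hne⟩
        · rw [← hkey]
          exact hL.key j k s hs r hr
        · refine ⟨fun h => absurd h (hne j s hs), ?_⟩
          rintro rfl
          rw [hidle] at hs
          exact absurd hs (Set.notMem_empty _)
      -- Placing `M.init` in slot `k` before the step keeps the keys coherent, so the trigger step
      -- too is an instance of following chosen paths.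
      let S : Fin M.size → Set M.Loc := fun j => if j = k then (L k).2 ∪ {M.init} else (L j).2
      have hS : ∀ j, ∀ s ∈ S j, s ∈ (L j).2 ∨ j = k ∧ s = M.init := by
        intro j s hs
        by_cases hj : j = k
        · subst hj
          simp only [S, if_true] at hs
          rcases hs with hs | hs
          · exact Or.inl hs
          · exact Or.inr ⟨rfl, hs⟩
        · simp only [S, if_neg hj] at hs
          exact Or.inl hs
      have hfol : ∀ j, Follows M H t (S j) (Function.update B k C j) := by
        intro j
        by_cases hj : j = k
        · subst hj
          simpa [S] using hCf
        · simpa [S, hj] using hB j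
      have hlive : ∀ j, ∀ s ∈ S j, ∃ k, FinishIn M H k t s := by
        intro j s hs
        rcases hS j s hs with hs | ⟨-, rfl⟩
        · exact hL.live j s hs
        · exact hinit
      have hkey : ∀ i j, ∀ s ∈ S i, ∀ s' ∈ S j,
          finishKey M H t s = finishKey M H t s' ↔ i = j := by
        intro i j s hs s' hs'
        rcases hS i s hs with hs₁ | ⟨hi, rfl⟩ <;> rcases hS j s' hs' with hs₂ | ⟨hj, rfl⟩
        · exact hL.key i j s hs₁ s' hs₂
        · rw [hj]
          exact hkinit i s hs₁
        · rw [hi, eq_comm, hkinit j s' hs₂, eq_comm]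
        · simp [hi, hj]
      refine ⟨Function.update B k C, Function.update (fun j => val j + w.delay t) k v,
        ⟨Function.update g k G, Function.update (fun _ => ∅) k R,
          Or.inr ⟨hp, k, by simpa using hC, fun j hj => by simpa [hj] using hstep j⟩, ?_, ?_⟩,
        .of_follows (S := S) hlive ?_ hkey hfol, ?_⟩
      · intro j
        by_cases hj : j = k
        · subst hj
          simpa using hG
        · simpa [hj] using hg j
      · intro j
        by_cases hj : j = k
        · subst hj
          simpa using hv
        · simp [hj]
      · intro j s hs
        by_cases hj : j = k
        · subst hj
          rw [Function.update_self]
          rcases hS j s hs with hs | ⟨-, rfl⟩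
          · exact hv₁ s hs
          · exact hv₂
        · rw [Function.update_of_ne hj]
          rcases hS j s hs with hs | ⟨h, -⟩
          · exact hL.time j s hs
          · exact absurd h hj
      · intro j s' hs' s hs
        obtain ⟨r, hr, hd, rfl⟩ := (hfol j).exists_eq s' hs'
        have h₁ := finishDist_next (hlive j r hr) hd
        have hs₂ : s ∈ S j := by
          by_cases hj : j = k
          · subst hj
            simp only [S, if_true]
            exact Or.inl hs
          · simpa only [S, if_neg hj] using hs
        have h₂ := finishDist_eq_of_key_eq ((hkey j j r hr s hs₂).2 rfl)
        omega
    rcases hk with ⟨r, hr, hkey⟩ | ⟨hidle, -⟩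
    · have hl : (L k).1 = 1 := by
        rcases hL.idle_or k with h | h
        · rw [h] at hr
          exact absurd hr (Set.notMem_empty _)
        · exact h.1
      have hkeys : ∀ s ∈ (L k).2, finishKey M H t s = finishKey M H t M.init :=
        fun s hs => ((hL.key k k s hs r hr).2 rfl).trans hkey
      have hposk : ∀ s ∈ (L k).2, 0 < finishDist M H t s := fun s hs => by
        rwa [finishDist_eq_of_key_eq (hkeys s hs)]
      obtain ⟨T', hT', hsub, hne⟩ := exists_orStep (σ := w.letter) (β := β) (t := t) (L k).2
        fun s hs => ⟨hL.live k s hs, hposk s hs⟩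
      -- The clock is not reset: the newcomer finishes when the group does, so the group's older
      -- deadline covers it.
      refine ⟨.top, ∅, (1, T' ∪ T), val k + w.delay t, .join (l := (L k).1) (Or.inl hl) hT' hT,
        trivial, ⟨fun h => absurd h (Set.notMem_empty _), fun _ => rfl⟩,
        ⟨Or.inr ⟨rfl, (hne ⟨r, hr⟩).inl⟩, ?_⟩, fun s hs => hL.time k s hs, ?_⟩
      · rintro s' (hs' | hs')
        · obtain ⟨s, hs, rfl⟩ := hsub hs'
          exact ⟨s, Or.inl hs, hposk s hs, rfl⟩
        · exact ⟨M.init, Or.inr rfl, hpos, hTnext s' hs'⟩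
      · rw [← hkey]
        exact hL.time k r hr
    -- With the clock at 0, the deadline is exactly the time bound `htimeinit` of the new
    -- obligation.
    · refine ⟨.top, {()}, (1, T), 0, hidle ▸ .start hT, trivial,
        ⟨fun _ => rfl, fun h => absurd rfl h⟩, ⟨Or.inr ⟨rfl, hTne ⟨_, rfl⟩⟩, ?_⟩, ?_, ?_⟩
      · exact fun s' hs' => ⟨M.init, Or.inr rfl, hpos, hTnext s' hs'⟩
      · intro s hs
        rw [hidle] at hs
        exact absurd hs (Set.notMem_empty _)
      · simpa using htimeinit

theorem mem_language_of_forall_exists_finishIn [Finite P] {p : P} {M : ModNFA n} {c : ℕ}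
    {β : Fin n → PosBool P} {w : TimedWord (Set P)}
    (hM : ∀ x : List (Fin n), M.Accepts x → 2 ≤ x.length)
    (hw : ∀ t, p ∈ w.letter t → ∃ k, w.time (t + k) ≤ c + w.time t ∧
        FinishIn M (fun l a => (β a).Holds (w.letter l)) k t M.init) :
    w ∈ (component p M c β).language := by
  set H : ℕ → Fin n → Prop := fun l a => (β a).Holds (w.letter l)
  have h₀ : Coherent M c H w 0 (fun _ => (0, ∅)) (fun _ => 0) :=
    ⟨fun _ => Or.inl rfl, fun _ _ h => absurd h (Set.notMem_empty _),
      fun _ _ h => absurd h (Set.notMem_empty _), fun _ _ _ h => absurd h (Set.notMem_empty _)⟩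
  -- Coherence sits inside the existential so that `choose` yields a total function, which can be
  -- iterated.
  have hex : ∀ t (x : (Fin M.size → SubLoc M) × (Fin M.size → ℝ≥0)),
      ∃ y : (Fin M.size → SubLoc M) × (Fin M.size → ℝ≥0), Coherent M c H w t x.1 x.2 →
        ComponentStep p M c β (w.letter t) x.1 y.1 (fun j => x.2 j + w.delay t) y.2 ∧
        Coherent M c H w (t + 1) y.1 y.2 ∧
        ∀ j, ∀ s' ∈ (y.1 j).2, ∀ s ∈ (x.1 j).2,
          finishDist M H (t + 1) s' < finishDist M H t s := by
    intro t x
    by_cases hx : Coherent M c H w t x.1 x.2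
    · obtain ⟨L', val', h⟩ := hx.exists_componentStep hM hw
      exact ⟨(L', val'), fun _ => h⟩
    · exact ⟨x, fun h => absurd h hx⟩
  choose next hnext using hex
  let st : ℕ → (Fin M.size → SubLoc M) × (Fin M.size → ℝ≥0) :=
    fun t => Nat.rec (fun _ => (0, ∅), fun _ => 0) next t
  have hcoh : ∀ t, Coherent M c H w t (st t).1 (st t).2 := by
    intro t
    induction t with
    | zero => exact h₀
    | succ t ih => exact (hnext t (st t) ih).2.1
  have hstep := fun t => hnext t (st t) (hcoh t)
  refine ⟨fun t => (st t).1, fun t => (st t).2,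
    (isRun_component_iff p M c β w _ _).2 ⟨rfl, fun _ => rfl, fun t => (hstep t).1⟩, ?_⟩
  have hidle : ∀ j d t, (∀ s ∈ ((st t).1 j).2, finishDist M H t s ≤ d) →
      ∃ t', t ≤ t' ∧ (st t').1 j = (0, ∅) := by
    intro j d
    induction d with
    | zero =>
      intro t ht
      rcases (hcoh t).idle_or j with h | ⟨-, s, hs⟩
      · exact ⟨t, le_rfl, h⟩
      · refine ⟨t + 1, Nat.le_succ t, ?_⟩
        rcases (hcoh (t + 1)).idle_or j with h | ⟨-, s', hs'⟩
        · exact h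
        · have h₁ := (hstep t).2.2 j s' hs' s hs
          have h₂ := ht s hs
          omega
    | succ d ih =>
      intro t ht
      rcases (hcoh t).idle_or j with h | ⟨-, s, hs⟩
      · exact ⟨t, le_rfl, h⟩
      · obtain ⟨t', h₁, h₂⟩ := ih (t + 1) fun s' hs' => by
          have h₁ := (hstep t).2.2 j s' hs' s hs
          have h₂ := ht s hs
          omega
        exact ⟨t', by omega, h₂⟩
  rintro F ⟨j, rfl⟩
  have hinf : {t | (st t).1 j = (0, ∅)}.Infinite := by
    refine Set.infinite_of_forall_exists_gt fun t => ?_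
    obtain ⟨d, hd⟩ :=
      (Set.toFinite (finishDist M H (t + 1) '' ((st (t + 1)).1 j).2)).bddAbove
    obtain ⟨t', h₁, h₂⟩ := hidle j d (t + 1) fun s hs => hd ⟨s, hs, rfl⟩
    exact ⟨t', h₂, h₁⟩
  -- Acceptance asks for one global location visited infinitely often. There are finitely many, so
  -- infinitely many visits to the set suffice.
  by_contra! hfin
  refine hinf (((Set.toFinite {K : Fin M.size → SubLoc M | (K j).1 = 0 ∨ (K j).1 = 2}).biUnion
    fun K hK => hfin K hK).subset fun t ht => ?_)
  refine Set.mem_biUnion (x := (st t).1) ?_ rfl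
  have ht' : (st t).1 j = (0, ∅) := ht
  exact Or.inl (by rw [ht'])

end Completeness

end TimedLogic

open TimedLogic in
theorem proposition7 {AP : Type u} [Finite AP] (φ : NNF AP) (n : ℕ) (M : ModNFA n) (c : ℕ)
    (args : Fin n → NNF AP) (hψ : NNF.aut n M (.le c) args ∈ φ.temporal)
    (hM : ∀ x : List (Fin n), M.Accepts x → 2 ≤ x.length) :
    (component (trigger _ hψ) M c
        (fun a => overline φ (args a) (NNF.temporal_arg_subset hψ a))).language =
      (EMITL.globally (EMITL.imp (EMITL.atom (trigger _ hψ))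
        (EMITL.aut n M (.le c)
          (fun a => (overline φ (args a) (NNF.temporal_arg_subset hψ a)).toEMITL)))).language := by
  ext w
  rw [mem_language_globally_iff]
  exact ⟨exists_finishIn_of_mem_language, mem_language_of_forall_exists_finishIn hM⟩
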